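/- Let $\mathcal B=(\mathcal G,\mathcal P,\iota)$ be a generalized Bayesian network over a finite set $\mathcal V$ of Boolean random variables: $\mathcal G=(\mathcal V,\mathcal E)$ is a directed graph, $\mathrm{Pre}(X)$ is the set of parents of $X$, and $\mathrm{Init}(\mathcal G)$ is the set of nodes without parents; $\mathcal P$ assigns to each non-initial node $X$ and each Boolean assignment $b$ of $\mathrm{Pre}(X)$ a distribution $\mathrm{Pr}(\cdot\mid b)$ over the values of $X$; and $\iota$ is an arbitrary joint distribution over the Boolean assignments of $\mathrm{Init}(\mathcal G)$. Assume that $\mathcal G$ is acyclic, and let $\mu$ be the distribution over the assignments of $\mathcal V$ given by \[ \mu(b)=\iota\bigl(b_{\mathrm{Init}(\mathcal G)}\bigr)\cdot\prod_{X\in\mathcal V\setminus\mathrm{Init}(\mathcal G)}\mathrm{Pr}\bigl(b_X\mid b_{\mathrm{Pre}(X)}\bigr). \] Let $\mathrm{Close}(\mathcal G)=\bigl(\mathcal V,\ \mathcal E\cup\{(A,B): A,B\in\mathrm{Init}(\mathcal G),\ A\neq B\}\bigr)$. Let $\mathcal X,\mathcal Y,\mathcal Z\subseteq\mathcal V$ be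 pairwise disjoint and suppose that $\mathcal X$ and $\mathcal Y$ are $d$-separated given $\mathcal Z$ in $\mathrm{Close}(\mathcal G)$, that is, every sequence $W_0,\dots,W_k$ of distinct nodes with $W_0\in\mathcal X$, $W_k\in\mathcal Y$ and, for each $i<k$, $W_i\to W_{i+1}$ or $W_i\leftarrow W_{i+1}$ in $\mathrm{Close}(\mathcal G)$, has an index $0<i<k$ such that, with edges taken in $\mathrm{Close}(\mathcal G)$, 1. $W_i\in\mathcal Z$ and one of $W_{i-1}\to W_i\to W_{i+1}$, $W_{i-1}\leftarrow W_i\leftarrow W_{i+1}$, $W_{i-1}\leftarrow W_i\to W_{i+1}$ holds, or 2. $W_{i-1}\to W_i\leftarrow W_{i+1}$ and no node reachable from $W_i$ (including $W_i$ itself) is in $\mathcal Z$. Then $\mathcal X$ and $\mathcal Y$ are independent given $\mathcal Z$ under $\mu$: for all assignments $a$ of $\mathcal X$, $b$ of $\mathcal Y$ and $c$ of $\mathcal Z$, either $\mu(a\mid b,c)=\mu(a\mid c)$ or $\mu(b,c)=0$. -/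

import Mathlib

namespace GenBN

/-! ### Assignments and distributions -/

/-- Boolean assignments over a set (type) of variables. -/
abbrev Asg (U : Type*) : Type _ := U → Bool

/-- The restriction of an assignment to a subset of the variables. -/
def restr {V : Type*} (U : Set V) (b : Asg V) : Asg U := fun X => b X.1

section Distributions

open scoped Classical

/-- Distributions over a finite set `S`: non-negative real functions on `S` with total sum one. -/
abbrev Dist (S : Type*) [Fintype S] : Type _ := stdSimplex ℝ S

/-- Full assignments that agree with the partial assignment `d` on `U`. -/
def cyl {V : Type*} {U : Set V} (d : Asg U) : Set (Asg V) :=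
  {b | restr U b = d}

/-- Probability of a set of assignments. -/
noncomputable def prob {V : Type*} [Fintype V] (μ : Dist (Asg V)) (φ : Set (Asg V)) : ℝ :=
  ∑ b with b ∈ φ, μ b

/-- Conditional probability of `φ` given `ψ`, meaningful when `prob μ ψ ≠ 0`. -/
noncomputable def condProb {V : Type*} [Fintype V] (μ : Dist (Asg V)) (φ ψ : Set (Asg V)) : ℝ :=
  prob μ (φ ∩ ψ) / prob μ ψ

/-- Triples of pairwise disjoint sets of variables. -/
def DisjointTriples (V : Type*) : Set (Set V × Set V × Set V) :=
  {t | Disjoint t.1 t.2.1 ∧ Disjoint t.1 t.2.2 ∧ Disjoint t.2.1 t.2.2}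

/-- The triples `(X, Y, Z)` of disjoint sets of variables such that `X` and `Y` are independent
under `μ` given `Z`. -/
def Indep {V : Type*} [Fintype V] (μ : Dist (Asg V)) : Set (Set V × Set V × Set V) :=
  {t | t ∈ DisjointTriples V ∧
    ∀ (a : Asg t.1) (b : Asg t.2.1) (c : Asg t.2.2),
      condProb μ (cyl a) (cyl b ∩ cyl c) = condProb μ (cyl a) (cyl c) ∨
        prob μ (cyl b ∩ cyl c) = 0}

end Distributions

/-! ### Directed graphs -/

/-- The parents of a node. -/
def pre {V : Type*} (G : Digraph V) (X : V) : Set V := {Y | G.Adj Y X}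

/-- The nodes reachable from `X`, including `X` itself. -/
def postStar {V : Type*} (G : Digraph V) (X : V) : Set V := {Y | Relation.ReflTransGen G.Adj X Y}

/-- The initial nodes, i.e. the nodes without parents. -/
def init {V : Type*} (G : Digraph V) : Set V := {X | pre G X = ∅}

/-- No directed cycles (in particular no self-loops). -/
def Acyclic {V : Type*} (G : Digraph V) : Prop := ∀ X, ¬ Relation.TransGen G.Adj X X

/-- The graph with all edges between distinct initial nodes added. -/
def close {V : Type*} (G : Digraph V) : Digraph V where
  Adj A B := G.Adj A B ∨ (A ∈ init G ∧ B ∈ init G ∧ A ≠ B)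

/-- `p` is the node sequence of a simple undirected path from `x` to `y`. -/
def IsSimplePath {V : Type*} (G : Digraph V) (x y : V) (p : List V) : Prop :=
  p.Nodup ∧ p.IsChain (fun u v => G.Adj u v ∨ G.Adj v u) ∧
    p.head? = some x ∧ p.getLast? = some y

/-- The path with node sequence `p` is blocked given `Z`: for some three consecutive nodes
`u, w, v` of `p`, either `w ∈ Z` is in a chain or fork, or `w` is in a collider and no node
reachable from `w` is in `Z`. -/
def Blocked {V : Type*} (G : Digraph V) (Z : Set V) (p : List V) : Prop :=
  ∃ u w v : V, [u, w, v] <:+: p ∧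
    ((((G.Adj u w ∧ G.Adj w v) ∨ (G.Adj w u ∧ G.Adj v w) ∨ (G.Adj w u ∧ G.Adj w v)) ∧ w ∈ Z) ∨
      ((G.Adj u w ∧ G.Adj v w) ∧ postStar G w ∩ Z = ∅))

/-- The triples `(X, Y, Z)` such that `X` and `Y` are d-separated given `Z`. -/
def dSep {V : Type*} (G : Digraph V) : Set (Set V × Set V × Set V) :=
  {t | ∀ x ∈ t.1, ∀ y ∈ t.2.1, ∀ p : List V, IsSimplePath G x y p → Blocked G t.2.2 p}

/-! ### Generalized Bayesian networks -/

section Networks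

open scoped Classical

/-- Generalized Bayesian networks over the finite set `V` of nodes. -/
structure GBN (V : Type*) [Fintype V] where
  /-- The directed graph, possibly with cycles. -/
  graph : Digraph V
  /-- The conditional probability tables of the non-initial nodes. -/
  cpt : (X : V) → X ∉ init graph → Asg (pre graph X) → Dist (Asg ({X} : Set V))
  /-- The joint distribution over the initial nodes. -/
  iota : Dist (Asg (init graph))

variable {V : Type*} [Fintype V]

/-- The value of the chain rule at a full assignment. -/
noncomputable def chainRule (B : GBN V) (b : Asg V) : ℝ :=
  B.iota (restr (init B.graph) b) *
    ∏ X : {X : V // X ∉ init B.graph},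
      B.cpt X.1 X.2 (restr (pre B.graph X.1) b) (restr ({X.1} : Set V) b)

/-- Summing out a sink: the normalized factor of a variable on which nothing else depends. -/
theorem two_mul_sum_mul (X : V) (g w : Asg V → ℝ)
    (hg : ∀ b x, g (Function.update b X x) = g b)
    (hw : ∀ b, w (Function.update b X true) + w (Function.update b X false) = 1) :
    2 * ∑ b, g b * w b = ∑ b, g b := by
  have hinv : Function.Involutive (fun b : Asg V => Function.update b X (!b X)) := by
    intro b; simp
  have h1 : ∑ b, g b * w b = ∑ b, g b * w (Function.update b X (!b X)) := by
    rw [← Equiv.sum_comp hinv.toPerm]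
    refine Finset.sum_congr rfl fun b _ => ?_
    simp [hg]
  rw [two_mul]
  nth_rewrite 2 [h1]
  rw [← Finset.sum_add_distrib]
  refine Finset.sum_congr rfl fun b _ => ?_
  rw [← mul_add]
  have h2 : w b + w (Function.update b X (!b X)) = 1 := by
    have h := hw b
    cases hb : b X
    · have : Function.update b X false = b := by rw [← hb]; simp
      rw [this] at h; simpa [add_comm] using h
    · have : Function.update b X true = b := by rw [← hb]; simp
      rw [this] at h; simpa using h
  rw [h2, mul_one]

/-- In an acyclic graph, every non-empty finite set of nodes has a sink. -/
theorem exists_sink {G : Digraph V} (hG : Acyclic G) {P : V → Prop} (S : Finset {X : V // P X})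
    (hS : S.Nonempty) : ∃ X ∈ S, ∀ Y ∈ S, ¬ G.Adj X.1 Y.1 := by
  have : Std.Irrefl (fun a b : V => Relation.TransGen G.Adj b a) := ⟨hG⟩
  have : IsTrans V (fun a b : V => Relation.TransGen G.Adj b a) :=
    ⟨fun _ _ _ h1 h2 => h2.trans h1⟩
  have hwf := Finite.wellFounded_of_trans_of_irrefl (fun a b : V => Relation.TransGen G.Adj b a)
  obtain ⟨X, hX, h⟩ := (InvImage.wf (fun X : {X : V // P X} => X.1) hwf).has_min {X | X ∈ S} hS
  exact ⟨X, hX, fun Y hY hXY => h Y hY (Relation.TransGen.single hXY)⟩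

/-- Partial chain-rule products have total weight as if every factor contributed one half. -/
theorem sum_partial (B : GBN V) (hB : Acyclic B.graph) (n : ℕ) :
    ∀ S : Finset {X : V // X ∉ init B.graph}, S.card = n →
      (2 : ℝ) ^ n * ∑ b : Asg V, B.iota (restr (init B.graph) b) *
        ∏ X ∈ S, B.cpt X.1 X.2 (restr (pre B.graph X.1) b) (restr ({X.1} : Set V) b) =
      ∑ b : Asg V, B.iota (restr (init B.graph) b) := by
  induction n with
  | zero =>
    intro S hS
    rw [Finset.card_eq_zero] at hS
    simp [hS]
  | succ n ih =>
    intro S hS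
    obtain ⟨X, hX, hsink⟩ := exists_sink hB S (Finset.card_pos.mp (by omega))
    rw [← ih (S.erase X) (by rw [Finset.card_erase_of_mem hX, hS]; rfl), pow_succ, mul_assoc]
    congr 1
    rw [← two_mul_sum_mul X.1
      (fun b => B.iota (restr (init B.graph) b) *
        ∏ Y ∈ S.erase X,
          B.cpt Y.1 Y.2 (restr (pre B.graph Y.1) b) (restr ({Y.1} : Set V) b))
      (fun b => B.cpt X.1 X.2 (restr (pre B.graph X.1) b) (restr ({X.1} : Set V) b))]
    · congr 1
      refine Finset.sum_congr rfl fun b _ => ?_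
      rw [← Finset.mul_prod_erase S _ hX]
      ring
    · intro b x
      have hr : ∀ U : Set V, X.1 ∉ U → restr U (Function.update b X.1 x) = restr U b := by
        intro U hU
        funext u
        have hu : u.1 ≠ X.1 := fun h => hU (h ▸ u.2)
        simp [restr, hu]
      rw [hr _ X.2]
      congr 1
      refine Finset.prod_congr rfl fun Y hY => ?_
      rw [Finset.mem_erase] at hY
      rw [hr _ (hsink Y hY.2), hr _ (fun h => hY.1 (Subtype.ext h.symm))]
    · intro b
      have hr : ∀ x, restr (pre B.graph X.1) (Function.update b X.1 x) =
          restr (pre B.graph X.1) b := by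
        intro x
        funext u
        have hu : u.1 ≠ X.1 := by
          intro h
          have h2 : B.graph.Adj u.1 X.1 := u.2
          rw [h] at h2
          exact hB X.1 (Relation.TransGen.single h2)
        simp [restr, hu]
      have hc : ∀ x, restr ({X.1} : Set V) (Function.update b X.1 x) = fun _ => x := by
        intro x
        funext u
        have hu : u.1 = X.1 := u.2
        simp [restr, hu]
      simp only [hr, hc]
      rw [← (B.cpt X.1 X.2 (restr (pre B.graph X.1) b)).2.2,
        ← Equiv.sum_comp (Equiv.funUnique ({X.1} : Set V) Bool).symm, Fintype.sum_bool]
      rfl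

/-- For acyclic networks the chain rule yields a distribution. -/
theorem chainRule_mem (B : GBN V) (hB : Acyclic B.graph) : chainRule B ∈ stdSimplex ℝ (Asg V) := by
  refine ⟨fun b => mul_nonneg (B.iota.2.1 _) (Finset.prod_nonneg fun X _ => (B.cpt _ _ _).2.1 _), ?_⟩
  have h := sum_partial B hB _ Finset.univ rfl
  have h2 : ∑ b : Asg V, B.iota (restr (init B.graph) b) =
      (2 : ℝ) ^ (Finset.univ : Finset {X : V // X ∉ init B.graph}).card := by
    rw [← Equiv.sum_comp (Equiv.piEquivPiSubtypeProd (· ∈ init B.graph) (fun _ => Bool)).symm,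
      Fintype.sum_prod_type]
    have hr : ∀ x y, restr (init B.graph)
        ((Equiv.piEquivPiSubtypeProd (· ∈ init B.graph) (fun _ => Bool)).symm (x, y)) = x := by
      intro x y
      funext u
      have hu : u.1 ∈ init B.graph := u.2
      simp [Equiv.piEquivPiSubtypeProd, restr, hu]
    simp only [hr, Finset.sum_const]
    rw [← Finset.smul_sum]
    have h3 : ∑ x, B.iota x = 1 := B.iota.2.2
    have h4 : (Finset.univ : Finset ({X : V // X ∉ init B.graph} → Bool)).card =
        2 ^ (Finset.univ : Finset {X : V // X ∉ init B.graph}).card := by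
      simp
    rw [h4, nsmul_eq_mul]
    push_cast
    erw [h3]
    rw [mul_one]
  rw [h2] at h
  exact mul_left_cancel₀ (by positivity) (h.trans (mul_one _).symm)

/-- The standard distribution of an acyclic network, given by the chain rule. -/
noncomputable def distBN (B : GBN V) (hB : Acyclic B.graph) : Dist (Asg V) :=
  ⟨chainRule B, chainRule_mem B hB⟩

end Networks

end GenBN

/-! Add a latent node `none` as a common parent of all initial nodes; the resulting graph is still
acyclic. It stands for the arbitrary joint law of the initial nodes just as the edges of the closure
do: a simple open trail through `none` becomes an unblocked path of the closure when `none` is cut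
out. Hence d-separation in the closure forbids open trails from Y to X in the latent graph
(`not_reach_of_dSep`).

Let C be the set of nodes outside Z that an open trail joins to Y. C contains Y and misses X. For
every ancestor n of X ∪ Y ∪ Z, the family of n (n and its parents) lies in C ∪ Z or in the
complement of C (`Reach.family`), and so does the set of initial nodes (`reach_init`). Non-ancestral
factors of the chain rule sum out (`prob_eq_of_ancestral`), so on the relevant events μ is, up to a
constant, a product Φ · Ψ with Φ depending on C ∪ Z and Ψ on the complement of C. Exchanging the
C-coordinates of two assignments that agree on Z then gives μ(a,b,c) μ(c) = μ(a,c) μ(b,c)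
(`sum_mul_sum_of_split`). -/

namespace GenBN

/-! ### Open trails in acyclic graphs -/

section Trails

variable {W : Type*}

/-- Lists whose consecutive pairs satisfy `A` and whose consecutive triples satisfy `R`. -/
def Trail (A : W → W → Prop) (R : W → W → W → Prop) : List W → Prop
  | u :: w :: v :: l => A u w ∧ R u w v ∧ Trail A R (w :: v :: l)
  | [u, v] => A u v
  | _ => True

variable {A : W → W → Prop} {R : W → W → W → Prop}

theorem Trail.tail {u : W} {l : List W} (h : Trail A R (u :: l)) : Trail A R l := by
  match l, h with
  | [], _ => trivial
  | [_], _ => trivial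
  | _ :: _ :: _, h => exact h.2.2

theorem Trail.head_pair {u w : W} {l : List W} (h : Trail A R (u :: w :: l)) : A u w := by
  match l, h with
  | [], h => exact h
  | _ :: _, h => exact h.1

/-- The pieces overlap in two nodes because `R` looks at triples: a triple that starts before `a`
ends at `b` or earlier, and every other one lies in the second piece. -/
theorem trail_append_iff (l₁ : List W) (a b : W) (l₂ : List W) :
    Trail A R (l₁ ++ a :: b :: l₂) ↔ Trail A R (l₁ ++ [a, b]) ∧ Trail A R (a :: b :: l₂) := by
  induction l₁ with
  | nil => exact ⟨fun h => ⟨h.head_pair, h⟩, fun h => h.2⟩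
  | cons c l ih =>
    match l, ih with
    | [], _ =>
      simp only [List.cons_append, List.nil_append, Trail]
      exact ⟨fun h => ⟨⟨h.1, h.2.1, h.2.2.head_pair⟩, h.2.2⟩, fun h => ⟨h.1.1, h.1.2.1, h.2⟩⟩
    | [d], ih =>
      simp only [List.cons_append, List.nil_append, Trail] at ih ⊢
      tauto
    | d :: e :: l, ih =>
      simp only [List.cons_append, Trail] at ih ⊢
      tauto

theorem Trail.append_right {l₁ l₂ : List W} (h : Trail A R (l₁ ++ l₂)) : Trail A R l₂ := by
  induction l₁ with
  | nil => exact h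
  | cons _ _ ih => exact ih h.tail

theorem Trail.append_left {l₁ l₂ : List W} (h : Trail A R (l₁ ++ l₂)) : Trail A R l₁ := by
  match l₁, h with
  | [], _ => trivial
  | [_], _ => trivial
  | [a, b], h => exact h.head_pair
  | a :: b :: c :: l, h => exact ⟨h.1, h.2.1, Trail.append_left (l₁ := b :: c :: l) h.2.2⟩

theorem Trail.isChain {l : List W} (h : Trail A R l) : l.IsChain A := by
  match l, h with
  | [], _ => exact List.IsChain.nil
  | [_], _ => exact List.IsChain.singleton _
  | a :: b :: l, h => exact List.IsChain.cons_cons h.head_pair (Trail.isChain h.tail)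

theorem Trail.of_infix {l : List W} (h : Trail A R l) {u w v : W} (hi : [u, w, v] <:+: l) :
    R u w v := by
  obtain ⟨s, t, rfl⟩ := hi
  exact (h.append_left.append_right : Trail A R [u, w, v]).2.1

theorem Trail.of_map {W' : Type*} {A' : W' → W' → Prop} {R' : W' → W' → W' → Prop} (f : W → W')
    (hA : ∀ u v, A' (f u) (f v) → A u v)
    (hR : ∀ u w v, A' (f u) (f w) → A' (f w) (f v) → R' (f u) (f w) (f v) → R u w v)
    {l : List W} (h : Trail A' R' (l.map f)) : Trail A R l := by
  match l, h with
  | [], _ => trivial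
  | [_], _ => trivial
  | [a, b], h => exact hA _ _ h
  | a :: b :: c :: l, h =>
    exact ⟨hA _ _ h.1, hR _ _ _ h.1 h.2.2.head_pair h.2.1,
      Trail.of_map f hA hR (l := b :: c :: l) h.2.2⟩

/-- The ancestors of a set of nodes, including the set itself. -/
def ancestors (H : Digraph W) (Z : Set W) : Set W :=
  {v | ∃ z ∈ Z, Relation.ReflTransGen H.Adj v z}

theorem subset_ancestors (H : Digraph W) (Z : Set W) : Z ⊆ ancestors H Z :=
  fun z hz => ⟨z, hz, .refl⟩

theorem mem_ancestors_of_adj {H : Digraph W} {Z : Set W} {u v : W} (h : H.Adj u v)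
    (hv : v ∈ ancestors H Z) : u ∈ ancestors H Z := by
  obtain ⟨z, hz, hvz⟩ := hv
  exact ⟨z, hz, .head h hvz⟩

/-- A node `w` between `u` and `v` lets information pass given `Z`. -/
def OpenAt (H : Digraph W) (Z : Set W) (u w v : W) : Prop :=
  (H.Adj u w ∧ H.Adj v w → w ∈ ancestors H Z) ∧ (¬ (H.Adj u w ∧ H.Adj v w) → w ∉ Z)

/-- Open trails given `Z`. -/
abbrev OpenTrail (H : Digraph W) (Z : Set W) : List W → Prop :=
  Trail (fun u v => H.Adj u v ∨ H.Adj v u) (OpenAt H Z)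

/-! ### Removing detours from open trails -/

variable {H : Digraph W} {Z : Set W}

theorem Acyclic.asymm (hH : Acyclic H) {u v : W} (h : H.Adj u v) : ¬ H.Adj v u :=
  fun h' => hH u (.head h (.single h'))

/-- An open trail that starts along an edge meets a collider or is directed. -/
theorem OpenTrail.mem_ancestors_or_transGen {u w : W} {l : List W}
    (h : OpenTrail H Z (u :: w :: l)) (huw : H.Adj u w) {y : W}
    (hy : (w :: l).getLast? = some y) :
    u ∈ ancestors H Z ∨ Relation.TransGen H.Adj u y := by
  induction l generalizing u w with
  | nil =>
    simp only [List.getLast?_singleton, Option.some.injEq] at hy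
    exact .inr (.single (hy ▸ huw))
  | cons v l ih =>
    -- Either `w` is an open collider, hence an ancestor of `Z`, or the trail continues forward.
    by_cases hvw : H.Adj v w
    · exact .inl (mem_ancestors_of_adj huw (h.2.1.1 ⟨huw, hvw⟩))
    · have hwv : H.Adj w v := h.2.2.head_pair.resolve_right hvw
      rcases ih h.2.2 hwv (by simpa using hy) with h' | h'
      · exact .inl (mem_ancestors_of_adj huw h')
      · exact .inr (.head huw h')

/-- Cutting a closed detour out of an open trail leaves an open trail. -/
theorem OpenTrail.shortcut (hH : Acyclic H) {w : W} {l₁ l₂ l₃ : List W}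
    (h : OpenTrail H Z (l₁ ++ w :: (l₂ ++ w :: l₃))) : OpenTrail H Z (l₁ ++ w :: l₃) := by
  rcases List.eq_nil_or_concat l₁ with rfl | ⟨l₁, t, rfl⟩
  · exact Trail.append_right (l₁ := w :: l₂) (by simpa using h)
  rcases l₃ with _ | ⟨v, l₃⟩
  · exact Trail.append_left (l₂ := l₂ ++ [w]) (by simpa using h)
  simp only [List.concat_eq_append, List.append_assoc, List.cons_append, List.nil_append] at h ⊢
  rw [OpenTrail, trail_append_iff] at h ⊢
  refine ⟨h.1, ?_⟩
  have hloop : OpenTrail H Z (w :: (l₂ ++ w :: v :: l₃)) := h.2.tail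
  have hend : OpenTrail H Z (w :: v :: l₃) := Trail.append_right (l₁ := w :: l₂) hloop
  refine ⟨h.2.head_pair, ?_, hend⟩
  -- Only the triple `t, w, v` is new. It is compared with the old triples `t, w, r` and `s, w, v`
  -- at the two ends of the detour.
  obtain ⟨r, l, hl⟩ : ∃ r l, l₂ ++ [w] = r :: l := by
    cases l₂ <;> simp
  have hl' : l₂ ++ w :: v :: l₃ = r :: (l ++ v :: l₃) := by
    rw [← List.cons_append, ← hl]; simp
  have hfirst : OpenAt H Z t w r := by
    have h2 := h.2
    rw [hl'] at h2
    exact h2.2.1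
  obtain ⟨s, hlast⟩ : ∃ s, OpenAt H Z s w v := by
    rcases List.eq_nil_or_concat (w :: l₂) with h0 | ⟨m, s, hm⟩
    · simp at h0
    · refine ⟨s, Trail.of_infix hloop ⟨m, l₃, ?_⟩⟩
      rw [← List.cons_append, hm]; simp
  constructor
  -- New collider: if the detour leaves `w` forward, it meets a collider below `w`, which makes `w`
  -- an ancestor of `Z`, or else it is a directed cycle.
  · rintro ⟨htw, -⟩
    by_cases hrw : H.Adj r w
    · exact hfirst.1 ⟨htw, hrw⟩
    · rw [hl'] at hloop
      have hwr : H.Adj w r := hloop.head_pair.resolve_right hrw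
      have hloop' : OpenTrail H Z (w :: r :: l) :=
        Trail.append_left (l₂ := v :: l₃) (by simpa using hloop)
      refine (hloop'.mem_ancestors_or_transGen hwr (y := w) ?_).resolve_right (hH w)
      rw [← hl]; simp
  -- New non-collider: one of the two old triples at `w` was already a non-collider.
  · intro hn
    by_cases htw : H.Adj t w
    · exact hlast.2 fun h' => hn ⟨htw, h'.2⟩
    · exact hfirst.2 fun h' => htw h'.1

theorem exists_eq_append_of_not_nodup {l : List W} (h : ¬ l.Nodup) :
    ∃ w l₁ l₂ l₃, l = l₁ ++ w :: (l₂ ++ w :: l₃) := by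
  induction l with
  | nil => simp at h
  | cons a l ih =>
    by_cases ha : a ∈ l
    · obtain ⟨s, t, rfl⟩ := List.append_of_mem ha
      exact ⟨a, [], s, t, rfl⟩
    · obtain ⟨w, l₁, l₂, l₃, rfl⟩ := ih fun hl => h (List.nodup_cons.2 ⟨ha, hl⟩)
      exact ⟨w, a :: l₁, l₂, l₃, rfl⟩

/-- Open trails can be made simple. -/
theorem OpenTrail.exists_nodup (hH : Acyclic H) {x y : W} (n : ℕ) :
    ∀ l : List W, l.length = n → OpenTrail H Z l → l.head? = some x → l.getLast? = some y →
      ∃ l' : List W, l'.Nodup ∧ OpenTrail H Z l' ∧ l'.head? = some x ∧ l'.getLast? = some y := by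
  induction n using Nat.strong_induction_on with
  | _ n ih =>
    intro l hn hl hx hy
    by_cases hd : l.Nodup
    · exact ⟨l, hd, hl, hx, hy⟩
    · obtain ⟨w, l₁, l₂, l₃, rfl⟩ := exists_eq_append_of_not_nodup hd
      refine ih _ ?_ _ rfl (OpenTrail.shortcut hH hl) ?_ ?_
      · simp only [List.length_append, List.length_cons] at hn ⊢
        omega
      · cases l₁ <;> simpa using hx
      · rw [← hy]
        simp [List.getLast?_append, List.getLast?_cons]

/-- Nodes joined to `Y` by an open trail given `Z`. -/
def Reach (H : Digraph W) (Z Y : Set W) (v : W) : Prop :=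
  ∃ l, ∃ y ∈ Y, OpenTrail H Z (v :: l) ∧ (v :: l).getLast? = some y

/-- Nodes joined to `Y` by an open trail given `Z` that does not enter them by an arrowhead. -/
def ReachOut (H : Digraph W) (Z Y : Set W) (v : W) : Prop :=
  ∃ l, (∃ y ∈ Y, OpenTrail H Z (v :: l) ∧ (v :: l).getLast? = some y) ∧
    ∀ t ∈ l.head?, H.Adj v t

/-! ### Propagation of reachability within families -/

variable {X Y : Set W}

theorem reach_of_mem {y : W} (hy : y ∈ Y) : Reach H Z Y y :=
  ⟨[], y, hy, trivial, rfl⟩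

/-- The node after `v` on the trail is unknown, so openness is required for every neighbour `t`. -/
theorem Reach.step {u v : W} (h : Reach H Z Y v) (hadj : H.Adj u v ∨ H.Adj v u)
    (ho : ∀ t, (H.Adj v t ∨ H.Adj t v) → OpenAt H Z u v t) : Reach H Z Y u := by
  obtain ⟨l, y, hy, hl, hlast⟩ := h
  refine ⟨v :: l, y, hy, ?_, by simpa using hlast⟩
  cases l with
  | nil => exact hadj
  | cons t l => exact ⟨hadj, ho t hl.head_pair, hl⟩

theorem openAt_of_adj_left (hH : Acyclic H) {u v t : W} (hv : v ∉ Z) (h : H.Adj v u) :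
    OpenAt H Z u v t :=
  ⟨fun h' => (hH.asymm h h'.1).elim, fun _ => hv⟩

theorem openAt_of_adj_right (hH : Acyclic H) {u v t : W} (hv : v ∉ Z) (h : H.Adj v t) :
    OpenAt H Z u v t :=
  ⟨fun h' => (hH.asymm h h'.2).elim, fun _ => hv⟩

theorem Reach.child (hH : Acyclic H) {v n : W} (h : Reach H Z Y v) (hv : v ∉ Z)
    (hvn : H.Adj v n) : Reach H Z Y n :=
  h.step (.inr hvn) fun _ _ => openAt_of_adj_left hH hv hvn

/-- A proper ancestor of `Z` outside `Z` is open both as a collider and as a non-collider. -/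
theorem Reach.parent {u n : W} (h : Reach H Z Y n) (hn : n ∉ Z) (hnZ : n ∈ ancestors H Z)
    (hun : H.Adj u n) : Reach H Z Y u :=
  h.step (.inl hun) fun _ _ => ⟨fun _ => hnZ, fun _ => hn⟩

/-- Passes through the collider at `n`. Here `n` may lie in `Z`, so this does not follow from
`Reach.child` and `Reach.parent`. -/
theorem Reach.coparent (hH : Acyclic H) {u v n : W} (h : Reach H Z Y v) (hv : v ∉ Z)
    (hnZ : n ∈ ancestors H Z) (hvn : H.Adj v n) (hun : H.Adj u n) : Reach H Z Y u := by
  obtain ⟨l, y, hy, hl, hlast⟩ := h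
  refine ⟨n :: v :: l, y, hy, ⟨.inl hun, ⟨fun _ => hnZ, fun h => (h ⟨hun, hvn⟩).elim⟩, ?_⟩,
    by simpa using hlast⟩
  cases l with
  | nil => exact .inr hvn
  | cons t l => exact ⟨.inr hvn, openAt_of_adj_left hH hv hvn, hl⟩

/-- A trail leaving `n` forward makes `n` a non-collider, so `n` need not be an ancestor of `Z`. -/
theorem ReachOut.parent (hH : Acyclic H) {u n : W} (h : ReachOut H Z Y n) (hn : n ∉ Z)
    (hun : H.Adj u n) : Reach H Z Y u := by
  obtain ⟨l, ⟨y, hy, hl, hlast⟩, hout⟩ := h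
  refine ⟨n :: l, y, hy, ?_, by simpa using hlast⟩
  cases l with
  | nil => exact .inl hun
  | cons t l => exact ⟨.inl hun, openAt_of_adj_right hH hn (hout t rfl), hl⟩

/-- A directed path from `n` to `Y` cannot meet `Z`, and it has no colliders, so it is open. -/
theorem reachOut_of_mem_ancestors (hH : Acyclic H) {n : W} (hn : n ∈ ancestors H Y)
    (hnZ : n ∉ ancestors H Z) : ReachOut H Z Y n := by
  obtain ⟨y, hy, hny⟩ := hn
  induction hny using Relation.ReflTransGen.head_induction_on with
  | refl => exact ⟨[], ⟨y, hy, trivial, rfl⟩, by simp⟩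
  | head hac _ ih =>
    rename_i c _
    have hc : c ∉ ancestors H Z := fun h => hnZ (mem_ancestors_of_adj hac h)
    have hcZ : c ∉ Z := fun h => hc (subset_ancestors H Z h)
    obtain ⟨l, ⟨y', hy', hl, hlast⟩, hout⟩ := ih hc
    refine ⟨c :: l, ⟨y', hy', ?_, by simpa using hlast⟩, by simpa using hac⟩
    cases l with
    | nil => exact .inl hac
    | cons t l => exact ⟨.inl hac, openAt_of_adj_right hH hcZ (hout t rfl), hl⟩

theorem Reach.exists_mem_of_mem_ancestors (hH : Acyclic H) {n : W} (h : Reach H Z Y n)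
    (hn : n ∈ ancestors H X) (hnZ : n ∉ ancestors H Z) : ∃ x ∈ X, Reach H Z Y x := by
  obtain ⟨x, hx, hnx⟩ := hn
  induction hnx using Relation.ReflTransGen.head_induction_on with
  | refl => exact ⟨x, hx, h⟩
  | head hac _ ih =>
    exact ih (h.child hH (fun h' => hnZ (subset_ancestors H Z h')) hac)
      fun h' => hnZ (mem_ancestors_of_adj hac h')

/-- If no open trail joins `Y` to `X`, the family of an ancestral node lies on one side. -/
theorem Reach.family (hH : Acyclic H) (hX : ∀ x ∈ X, ¬ Reach H Z Y x) {n s s' : W}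
    (hn : n ∈ ancestors H (X ∪ Y ∪ Z)) (hs : s = n ∨ H.Adj s n) (hs' : s' = n ∨ H.Adj s' n)
    (hsZ : s ∉ Z) (h : Reach H Z Y s) : Reach H Z Y s' := by
  -- If `n` is not an ancestor of `Z`, it is one of `X` or `Y`. The first would extend the trail
  -- down to `X`; in the second case the trail is replaced by a directed path to `Y`.
  have key : ∀ u, n ∉ Z → Reach H Z Y n → H.Adj u n → Reach H Z Y u := by
    intro u hnZ hr hun
    by_cases ha : n ∈ ancestors H Z
    · exact hr.parent hnZ ha hun
    · obtain ⟨z, (hz | hz) | hz, hnz⟩ := hn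
      · obtain ⟨x, hx, hrx⟩ := hr.exists_mem_of_mem_ancestors hH ⟨z, hz, hnz⟩ ha
        exact (hX x hx hrx).elim
      · exact (reachOut_of_mem_ancestors hH ⟨z, hz, hnz⟩ ha).parent hH hnZ hun
      · exact (ha ⟨z, hz, hnz⟩).elim
  rcases hs with rfl | hs <;> rcases hs' with rfl | hs'
  · exact h
  · exact key _ hsZ h hs'
  · exact h.child hH hsZ hs
  · by_cases ha : n ∈ ancestors H Z
    · exact h.coparent hH hsZ ha hs hs'
    · exact key _ (fun h' => ha (subset_ancestors H Z h')) (h.child hH hsZ hs) hs'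

end Trails

/-! ### A latent common cause of the initial nodes -/

section Latent

variable {V : Type*} {G : Digraph V}

/-- The graph with a new node `none` that is the parent of all initial nodes. -/
def latent (G : Digraph V) : Digraph (Option V) where
  Adj
    | none, some v => v ∈ init G
    | some u, some v => G.Adj u v
    | _, none => False

theorem latent_adj_some {u v : V} : (latent G).Adj (some u) (some v) ↔ G.Adj u v := Iff.rfl

theorem not_latent_adj_none (a : Option V) : ¬ (latent G).Adj a none := by
  cases a <;> exact id

theorem not_transGen_latent_none (a : Option V) : ¬ Relation.TransGen (latent G).Adj a none := by
  intro h
  obtain ⟨_, _, h'⟩ := Relation.TransGen.tail'_iff.1 h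
  exact not_latent_adj_none _ h'

theorem transGen_of_latent {u v : V}
    (h : Relation.TransGen (latent G).Adj (some u) (some v)) : Relation.TransGen G.Adj u v := by
  generalize hb : (some v : Option V) = b at h
  induction h generalizing v with
  | single h => subst hb; exact .single h
  | @tail c _ hc h ih =>
    subst hb
    cases c with
    | none => exact (not_transGen_latent_none _ hc).elim
    | some c => exact .tail (ih rfl) h

theorem acyclic_latent (hG : Acyclic G) : Acyclic (latent G) := by
  rintro (_ | v) h
  · exact not_transGen_latent_none _ h
  · exact hG v (transGen_of_latent h)

theorem not_adj_of_mem_init {u v : V} (hv : v ∈ init G) : ¬ G.Adj u v := fun h => by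
  have : u ∈ pre G v := h
  rw [show pre G v = ∅ from hv] at this
  exact this

/-- Added edges join initial nodes, which are never adjacent in `G`, so edges of `G` keep their
orientation in the closure. -/
theorem adj_of_close {u v : V} (h : G.Adj u v ∨ G.Adj v u) (hc : (close G).Adj u v) :
    G.Adj u v := by
  rcases hc with hc | ⟨hu, hv, -⟩
  · exact hc
  · exact h.elim id fun h => (not_adj_of_mem_init hu h).elim

/-- Blocking of a path at three consecutive nodes. -/
def BlockedAt (G : Digraph V) (Z : Set V) (u w v : V) : Prop :=
  (((G.Adj u w ∧ G.Adj w v) ∨ (G.Adj w u ∧ G.Adj v w) ∨ (G.Adj w u ∧ G.Adj w v)) ∧ w ∈ Z) ∨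
    ((G.Adj u w ∧ G.Adj v w) ∧ postStar G w ∩ Z = ∅)

theorem BlockedAt.symm {Z : Set V} {u w v : V} (h : BlockedAt G Z u w v) :
    BlockedAt G Z v w u := by
  unfold BlockedAt at *
  tauto

theorem not_blockedAt_close (hG : Acyclic G) {Z : Set V} {u w v : V}
    (huw : G.Adj u w ∨ G.Adj w u) (hwv : G.Adj w v ∨ G.Adj v w)
    (h : OpenAt (latent G) (some '' Z) (some u) (some w) (some v)) :
    ¬ BlockedAt (close G) Z u w v := by
  rintro (⟨hb, hw⟩ | ⟨⟨h1, h2⟩, hb⟩)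
  · refine h.2 (fun hcol => ?_) ⟨w, hw, rfl⟩
    have h1 : ¬ G.Adj w u := hG.asymm hcol.1
    have h2 : ¬ G.Adj w v := hG.asymm hcol.2
    rcases hb with ⟨-, hb⟩ | ⟨hb, -⟩ | ⟨hb, -⟩
    · exact h2 (adj_of_close hwv hb)
    · exact h1 (adj_of_close huw.symm hb)
    · exact h1 (adj_of_close huw.symm hb)
  · obtain ⟨_, ⟨z, hz, rfl⟩, hr⟩ := h.1
      ⟨latent_adj_some.2 (adj_of_close huw h1), latent_adj_some.2 (adj_of_close hwv.symm h2)⟩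
    have hz' : z ∈ postStar (close G) w ∩ Z := by
      refine ⟨?_, hz⟩
      rcases Relation.reflTransGen_iff_eq_or_transGen.1 hr with he | ht
      · rw [Option.some_injective _ he]; exact .refl
      · exact Relation.ReflTransGen.lift (r := G.Adj) (p := (close G).Adj) (fun v => v)
          (fun _ _ h => Or.inl h) _ _ (transGen_of_latent ht).to_reflTransGen
    rw [hb] at hz'
    exact hz'

/-- A trail may pass from one initial node to another in the closure. -/
theorem not_blockedAt_close_init {Z : Set V} {a b c : V} (hb : b ∈ init G) (hbc : G.Adj b c)
    (h : OpenAt (latent G) (some '' Z) none (some b) (some c)) :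
    ¬ BlockedAt (close G) Z a b c := by
  have hcb : ¬ G.Adj c b := not_adj_of_mem_init hb
  have hbZ : b ∉ Z := fun hz => h.2 (fun h' => hcb h'.2) ⟨b, hz, rfl⟩
  rintro (⟨-, hz⟩ | ⟨⟨-, hadj⟩, -⟩)
  · exact hbZ hz
  · exact hcb (adj_of_close (.inr hbc) hadj)

theorem OpenAt.symm {W : Type*} {H : Digraph W} {Z : Set W} {u w v : W} (h : OpenAt H Z u w v) :
    OpenAt H Z v w u :=
  ⟨fun h' => h.1 h'.symm, fun h' => h.2 fun h'' => h' h''.symm⟩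

/-- Unblocked trails in a graph. -/
abbrev FreeTrail (G : Digraph V) (Z : Set V) : List V → Prop :=
  Trail (fun u v => G.Adj u v ∨ G.Adj v u) (fun u w v => ¬ BlockedAt G Z u w v)

theorem freeTrail_of_map_some (hG : Acyclic G) {Z : Set V} {l : List V}
    (h : OpenTrail (latent G) (some '' Z) (l.map some)) : FreeTrail (close G) Z l :=
  Trail.of_map some (fun _ _ h => h.imp .inl .inl)
    (fun _ _ _ h1 h2 h3 => not_blockedAt_close hG h1 h2 h3) h

theorem freeTrail_of_latent_mem (hG : Acyclic G) {Z : Set V} {l₁ l₂ : List V} {a b : V}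
    (hab : a ≠ b)
    (h : OpenTrail (latent G) (some '' Z)
      (l₁.map some ++ some a :: none :: some b :: l₂.map some)) :
    FreeTrail (close G) Z (l₁ ++ a :: b :: l₂) := by
  have hleft : OpenTrail (latent G) (some '' Z) (l₁.map some ++ [some a, none]) :=
    ((trail_append_iff _ _ _ _).1 h).1
  have hright : OpenTrail (latent G) (some '' Z) (none :: some b :: l₂.map some) :=
    ((trail_append_iff _ _ _ _).1 h).2.tail
  have ha : a ∈ init G :=
    (((trail_append_iff _ _ _ _).1 h).2.head_pair).resolve_left (not_latent_adj_none _)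
  have hb : b ∈ init G := hright.head_pair.resolve_right (not_latent_adj_none _)
  have hadj : (close G).Adj a b ∨ (close G).Adj b a := .inl (.inr ⟨ha, hb, hab⟩)
  rw [FreeTrail, trail_append_iff]
  constructor
  · rcases List.eq_nil_or_concat l₁ with rfl | ⟨l₁, t, rfl⟩
    · exact hadj
    · simp only [List.concat_eq_append, List.map_append, List.map_cons, List.map_nil,
        List.append_assoc, List.cons_append, List.nil_append] at hleft ⊢
      rw [trail_append_iff]
      rw [OpenTrail, trail_append_iff] at hleft
      have hl : FreeTrail (close G) Z (l₁ ++ [t, a]) :=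
        freeTrail_of_map_some hG (by simpa using hleft.1)
      have hta : G.Adj a t := hleft.2.1.resolve_left fun h' =>
        not_adj_of_mem_init ha (latent_adj_some.1 h')
      refine ⟨hl, .inr (.inl hta), fun hbl => ?_, hadj⟩
      exact not_blockedAt_close_init ha hta hleft.2.2.1.symm hbl.symm
  · cases l₂ with
    | nil => exact hadj
    | cons c l₂ =>
      have hr : FreeTrail (close G) Z (b :: c :: l₂) :=
        freeTrail_of_map_some hG (by simpa using hright.tail)
      have hbc : G.Adj b c :=
        (hright.tail.head_pair).resolve_right fun h' =>
          not_adj_of_mem_init hb (latent_adj_some.1 h')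
      exact ⟨hadj, not_blockedAt_close_init hb hbc hright.2.1, hr⟩

theorem exists_map_some {l : List (Option V)} (h : none ∉ l) : ∃ l' : List V, l = l'.map some := by
  induction l with
  | nil => exact ⟨[], rfl⟩
  | cons a l ih =>
    obtain ⟨l', rfl⟩ := ih fun h' => h (List.mem_cons_of_mem _ h')
    cases a with
    | none => simp at h
    | some a => exact ⟨a :: l', rfl⟩

/-- d-separation in the closure excludes open trails in the graph with the latent node. -/
theorem not_reach_of_dSep (hG : Acyclic G) {X Y Z : Set V}
    (h : (X, Y, Z) ∈ dSep (close G)) {x : V} (hx : x ∈ X) :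
    ¬ Reach (latent G) (some '' Z) (some '' Y) (some x) := by
  rintro ⟨l, _, ⟨y, hy, rfl⟩, hl, hlast⟩
  obtain ⟨p, hnd, hp, hpx, hpy⟩ := OpenTrail.exists_nodup (acyclic_latent hG) _ _ rfl hl rfl hlast
  obtain ⟨q, hqnd, hq, hqx, hqy⟩ : ∃ q : List V, q.Nodup ∧ FreeTrail (close G) Z q ∧
      q.head? = some x ∧ q.getLast? = some y := by
    -- In a simple trail `none` occurs at most once, so at most one edge of the closure replaces it,
    -- and its ends are distinct.
    by_cases hnone : none ∈ p
    · obtain ⟨s, t, rfl⟩ := List.append_of_mem hnone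
      have hst := (List.nodup_middle.1 hnd).notMem
      have hs : none ∉ s := fun h' => hst (List.mem_append_left _ h')
      have ht : none ∉ t := fun h' => hst (List.mem_append_right _ h')
      obtain ⟨s, rfl⟩ := exists_map_some hs
      obtain ⟨t, rfl⟩ := exists_map_some ht
      rcases List.eq_nil_or_concat s with rfl | ⟨s, a, rfl⟩
      · simp at hpx
      rcases t with _ | ⟨b, t⟩
      · simp at hpy
      have hnd' : (s ++ a :: b :: t).Nodup := by
        have : ((s ++ a :: b :: t).map some).Nodup := by
          refine hnd.sublist ?_
          simp
        exact this.of_map _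
      refine ⟨s ++ a :: b :: t, hnd', freeTrail_of_latent_mem hG ?_ (by simpa using hp), ?_, ?_⟩
      · rintro rfl
        simp [List.nodup_append] at hnd'
      · cases s <;> simpa using hpx
      · simpa [List.getLast?_append, List.getLast?_cons, List.getLast?_map] using hpy
    · obtain ⟨q, rfl⟩ := exists_map_some hnone
      refine ⟨q, hnd.of_map _, freeTrail_of_map_some hG hp, ?_, ?_⟩
      · simpa using hpx
      · simpa [List.getLast?_map] using hpy
  obtain ⟨u, w, v, hi, hb⟩ := h x hx y hy q ⟨hqnd, hq.isChain, hqx, hqy⟩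
  exact hq.of_infix hi hb

/-- All initial nodes outside `Z` lie on the same side. -/
theorem reach_init (hG : Acyclic G) {Y Z : Set V} {i j : V} (hi : i ∈ init G) (hj : j ∈ init G)
    (hiZ : i ∉ Z) (h : Reach (latent G) (some '' Z) (some '' Y) (some i)) :
    Reach (latent G) (some '' Z) (some '' Y) (some j) := by
  have hH := acyclic_latent hG
  have hiZ' : (some i : Option V) ∉ some '' Z := by simpa using hiZ
  -- A trail from `i` is empty, starts through `none`, or goes to a child of `i`; in the last case
  -- `none → i → t` is an open chain.
  have hnone : Reach (latent G) (some '' Z) (some '' Y) none := by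
    obtain ⟨l, y, hy, hl, hlast⟩ := h
    match l, hl, hlast with
    | [], hl, hlast =>
      exact ⟨[some i], y, hy, .inl hi, by simpa using hlast⟩
    | none :: l, hl, hlast => exact ⟨l, y, hy, hl.tail, by simpa using hlast⟩
    | some t :: l, hl, hlast =>
      have hit : (latent G).Adj (some i) (some t) :=
        hl.head_pair.resolve_right fun h' => not_adj_of_mem_init hi (latent_adj_some.1 h')
      exact ⟨some i :: some t :: l, y, hy, ⟨.inl hi, openAt_of_adj_right hH hiZ' hit, hl⟩,
        by simpa using hlast⟩
  exact hnone.child hH (by simp) hj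

end Latent

/-! ### Factorizations -/

section Factors

open scoped Classical

variable {V : Type*}

theorem mem_cyl {U : Set V} {d : Asg U} {b : Asg V} : b ∈ cyl d ↔ ∀ v : U, b v = d v :=
  funext_iff

/-- The total weight of a set of assignments. -/
noncomputable def mass [Fintype V] (f : Asg V → ℝ) (φ : Set (Asg V)) : ℝ :=
  ∑ b with b ∈ φ, f b

/-- A weight that splits along `C` given `Z` satisfies the independence identity. -/
theorem sum_mul_sum_of_split [Fintype V] {X Y Z C : Set V} (hX : Disjoint X C) (hY : Y ⊆ C)
    (hZ : Disjoint Z C) {Φ Ψ : Asg V → ℝ} (hΦ : DependsOn Φ (C ∪ Z)) (hΨ : DependsOn Ψ Cᶜ)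
    (a : Asg X) (b : Asg Y) (c : Asg Z) :
    mass (fun β => Φ β * Ψ β) (cyl a ∩ (cyl b ∩ cyl c)) * mass (fun β => Φ β * Ψ β) (cyl c) =
      mass (fun β => Φ β * Ψ β) (cyl a ∩ cyl c) * mass (fun β => Φ β * Ψ β) (cyl b ∩ cyl c) := by
  unfold mass
  rw [Finset.sum_mul_sum, Finset.sum_mul_sum, ← Finset.sum_product', ← Finset.sum_product']
  -- The involution exchanging C-coordinates moves the condition `b` to the other assignment and
  -- leaves `a` and `c` in place.
  let σ : Asg V × Asg V → Asg V × Asg V := fun p => (C.piecewise p.2 p.1, C.piecewise p.1 p.2)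
  have hσσ : ∀ p, σ (σ p) = p := by
    rintro ⟨p, q⟩
    refine Prod.ext (funext fun v => ?_) (funext fun v => ?_) <;>
      by_cases hv : v ∈ C <;> simp [σ, hv]
  have hXC : ∀ v : X, v.1 ∉ C := fun v => Set.disjoint_left.1 hX v.2
  have hZC : ∀ v : Z, v.1 ∉ C := fun v => Set.disjoint_left.1 hZ v.2
  have hYC : ∀ v : Y, v.1 ∈ C := fun v => hY v.2
  refine Finset.sum_nbij' σ σ ?_ ?_ (fun p _ => hσσ p) (fun p _ => hσσ p) ?_
  · rintro ⟨p, q⟩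
    simp only [Finset.mem_product, Finset.mem_filter, Finset.mem_univ, true_and, Set.mem_inter_iff,
      mem_cyl, σ, Set.piecewise_eq_of_notMem _ _ _ (hXC _),
      Set.piecewise_eq_of_notMem _ _ _ (hZC _), Set.piecewise_eq_of_mem _ _ _ (hYC _)]
    tauto
  · rintro ⟨p, q⟩
    simp only [Finset.mem_product, Finset.mem_filter, Finset.mem_univ, true_and, Set.mem_inter_iff,
      mem_cyl, σ, Set.piecewise_eq_of_notMem _ _ _ (hXC _),
      Set.piecewise_eq_of_notMem _ _ _ (hZC _), Set.piecewise_eq_of_mem _ _ _ (hYC _)]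
    tauto
  · rintro ⟨p, q⟩ hpq
    simp only [Finset.mem_product, Finset.mem_filter, Finset.mem_univ, true_and, Set.mem_inter_iff,
      mem_cyl] at hpq
    -- Φ also sees `Z`, where both assignments equal `c`.
    have h1 : ∀ p q : Asg V, (∀ v : Z, p v = q v) → Φ (C.piecewise p q) = Φ p := by
      intro p q h
      refine hΦ ?_
      rintro v (hv | hv)
      · simp [hv]
      · rw [Set.piecewise_eq_of_notMem _ _ _ (hZC ⟨v, hv⟩), h ⟨v, hv⟩]
    have h2 : ∀ p q : Asg V, Ψ (C.piecewise p q) = Ψ q := fun p q =>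
      hΨ fun v hv => Set.piecewise_eq_of_notMem _ _ _ hv
    have hZpq : ∀ v : Z, p v = q v := fun v => (hpq.1.2.2 v).trans (hpq.2 v).symm
    simp only [σ, h2, h1 p q hZpq, h1 q p fun v => (hZpq v).symm]
    ring

theorem dependsOn_prod {ι : Type*} (s : Finset ι) (F : ι → Asg V → ℝ) (T : Set V)
    (h : ∀ i ∈ s, DependsOn (F i) T) : DependsOn (fun b => ∏ i ∈ s, F i b) T :=
  fun _ _ hxy => Finset.prod_congr rfl fun i hi => h i hi hxy

/-- A product of factors whose scopes lie on one side of `C` given `Z` splits. -/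
theorem exists_split {ι : Type*} (s : Finset ι) (F : ι → Asg V → ℝ) (scope : ι → Set V)
    (C Z : Set V) (hF : ∀ i, DependsOn (F i) (scope i))
    (hs : ∀ i ∈ s, scope i ⊆ C ∪ Z ∨ scope i ⊆ Cᶜ) :
    ∃ Φ Ψ : Asg V → ℝ, DependsOn Φ (C ∪ Z) ∧ DependsOn Ψ Cᶜ ∧
      ∀ b, ∏ i ∈ s, F i b = Φ b * Ψ b := by
  refine ⟨_, _, dependsOn_prod (s.filter fun i => scope i ⊆ C ∪ Z) F _ fun i hi _ _ hxy => ?_,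
    dependsOn_prod (s.filter fun i => ¬ scope i ⊆ C ∪ Z) F _ fun i hi _ _ hxy => ?_,
    fun b => (Finset.prod_filter_mul_prod_filter_not s _ _).symm⟩
  · exact hF i fun v hv => hxy v ((Finset.mem_filter.1 hi).2 hv)
  · have h := Finset.mem_filter.1 hi
    exact hF i fun v hv => hxy v ((hs i h.1).resolve_left h.2 hv)

theorem restr_congr {U : Set V} {b b' : Asg V} (h : ∀ v ∈ U, b v = b' v) :
    restr U b = restr U b' :=
  funext fun v => h v.1 v.2

theorem dependsOn_mem_cyl {U T : Set V} (h : U ⊆ T) (d : Asg U) :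
    DependsOn (fun b : Asg V => b ∈ cyl d) T := by
  intro b b' hb
  simp only [cyl, Set.mem_ofPred_eq, restr_congr fun v hv => hb v (h hv)]

theorem dependsOn_mem_inter {T : Set V} {φ ψ : Set (Asg V)} (hφ : DependsOn (fun b => b ∈ φ) T)
    (hψ : DependsOn (fun b => b ∈ ψ) T) : DependsOn (fun b => b ∈ φ ∩ ψ) T := by
  intro b b' hb
  have h1 : (b ∈ φ) = (b' ∈ φ) := hφ hb
  have h2 : (b ∈ ψ) = (b' ∈ ψ) := hψ hb
  simp only [Set.mem_inter_iff, h1, h2]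

theorem dependsOn_update {g : Asg V → ℝ} {T : Set V} (hg : DependsOn g T) {X : V} (hX : X ∉ T)
    (b : Asg V) (x : Bool) : g (Function.update b X x) = g b :=
  hg fun _ hv => Function.update_of_ne (ne_of_mem_of_not_mem hv hX) _ _

/-- d-separation in the closure yields a splitting set. -/
theorem exists_separating_set {G : Digraph V} (hG : Acyclic G) {X Y Z : Set V}
    (h : (X, Y, Z) ∈ dSep (close G)) (hYZ : Disjoint Y Z) :
    ∃ C : Set V, Disjoint X C ∧ Y ⊆ C ∧ Disjoint Z C ∧
      (init G ⊆ C ∪ Z ∨ init G ⊆ Cᶜ) ∧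
      ∀ n ∈ ancestors G (X ∪ Y ∪ Z),
        insert n (pre G n) ⊆ C ∪ Z ∨ insert n (pre G n) ⊆ Cᶜ := by
  -- If membership in C spreads from one node of `S` to all of `S` outside `Z`, then `S` does not
  -- straddle C.
  have side : ∀ (P : V → Prop) (S : Set V),
      (∀ s ∈ S, ∀ s' ∈ S, s ∉ Z → P s → P s') →
      S ⊆ {v | v ∉ Z ∧ P v} ∪ Z ∨ S ⊆ {v | v ∉ Z ∧ P v}ᶜ := by
    intro P S hS
    by_cases hex : ∃ s ∈ S, s ∉ Z ∧ P s
    · obtain ⟨s, hs, hsZ, hPs⟩ := hex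
      refine .inl fun s' hs' => ?_
      by_cases hZ : s' ∈ Z
      · exact .inr hZ
      · exact .inl ⟨hZ, hS s hs s' hs' hsZ hPs⟩
    · exact .inr fun s hs h' => hex ⟨s, hs, h'⟩
  refine ⟨{v | v ∉ Z ∧ Reach (latent G) (some '' Z) (some '' Y) (some v)},
    Set.disjoint_left.2 fun x hx h' => not_reach_of_dSep hG h hx h'.2,
    fun y hy => ⟨Set.disjoint_left.1 hYZ hy, reach_of_mem ⟨y, hy, rfl⟩⟩,
    Set.disjoint_left.2 fun z hz h' => h'.1 hz, side _ _ ?_, fun n hn => side _ _ ?_⟩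
  · exact fun i hi j hj hiZ hr => reach_init hG hi hj hiZ hr
  · intro s hs s' hs' hsZ hr
    refine Reach.family (acyclic_latent hG) (X := some '' X) (n := some n) ?_ ?_ ?_ ?_
      (by simpa using hsZ) hr
    · rintro _ ⟨x, hx, rfl⟩
      exact not_reach_of_dSep hG h hx
    · obtain ⟨z, hz, hnz⟩ := hn
      refine ⟨some z, ?_, hnz.lift some fun _ _ h => h⟩
      simpa using hz
    · exact hs.imp (congrArg some) id
    · exact hs'.imp (congrArg some) id

/-! ### Chain-rule factors and reduction to ancestral sets -/

variable [Fintype V]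

/-- The factors of the chain rule. -/
noncomputable def factor (B : GBN V) : Option {X : V // X ∉ init B.graph} → Asg V → ℝ
  | none => fun b => B.iota (restr (init B.graph) b)
  | some X => fun b => B.cpt X.1 X.2 (restr (pre B.graph X.1) b) (restr ({X.1} : Set V) b)

/-- The variables on which the factors of the chain rule depend. -/
def scope (B : GBN V) : Option {X : V // X ∉ init B.graph} → Set V
  | none => init B.graph
  | some X => insert X.1 (pre B.graph X.1)

theorem dependsOn_factor (B : GBN V) (k) : DependsOn (factor B k) (scope B k) := by
  intro b b' h
  cases k with
  | none => simp only [factor]; rw [restr_congr (U := init B.graph) h]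
  | some X =>
    simp only [factor]
    rw [restr_congr (U := pre B.graph X.1) fun v hv => h v (.inr hv),
      restr_congr (U := ({X.1} : Set V)) fun v hv => h v (.inl hv)]

/-- The two values of a table entry sum to one. -/
theorem factor_update_add (B : GBN V) (hB : Acyclic B.graph) (X : {X : V // X ∉ init B.graph})
    (b : Asg V) : factor B (some X) (Function.update b X.1 true) +
      factor B (some X) (Function.update b X.1 false) = 1 := by
  have hr : ∀ x, restr (pre B.graph X.1) (Function.update b X.1 x) =
      restr (pre B.graph X.1) b := fun x => restr_congr fun v hv =>
    Function.update_of_ne (fun h => hB X.1 (.single (by subst h; exact hv))) _ _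
  have hc : ∀ x, restr ({X.1} : Set V) (Function.update b X.1 x) = fun _ => x := by
    intro x
    funext u
    have hu : u.1 = X.1 := u.2
    simp [restr, hu]
  simp only [factor, hr, hc]
  rw [← (B.cpt X.1 X.2 (restr (pre B.graph X.1) b)).2.2,
    ← Equiv.sum_comp (Equiv.funUnique ({X.1} : Set V) Bool).symm, Fintype.sum_bool]
  rfl

/-- Factors of variables that do not occur elsewhere can be summed out. -/
theorem sum_out (B : GBN V) (hB : Acyclic B.graph) {g : Asg V → ℝ} {T : Set V}
    (hg : DependsOn g T) (n : ℕ) : ∀ S : Finset {X : V // X ∉ init B.graph}, S.card = n →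
      (∀ X ∈ S, X.1 ∉ T) →
      (2 : ℝ) ^ n * ∑ b, g b * ∏ X ∈ S, factor B (some X) b = ∑ b, g b := by
  induction n with
  | zero =>
    intro S hS _
    rw [Finset.card_eq_zero] at hS
    simp [hS]
  | succ n ih =>
    intro S hS hT
    obtain ⟨X, hX, hsink⟩ := exists_sink hB S (Finset.card_pos.mp (by omega))
    rw [← ih (S.erase X) (by rw [Finset.card_erase_of_mem hX, hS]; rfl)
      fun Y hY => hT Y (Finset.mem_of_mem_erase hY), pow_succ, mul_assoc]
    congr 1
    rw [← two_mul_sum_mul X.1 (fun b => g b * ∏ Y ∈ S.erase X, factor B (some Y) b)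
      (factor B (some X)) _ (factor_update_add B hB X)]
    · congr 1
      refine Finset.sum_congr rfl fun b _ => ?_
      rw [← Finset.mul_prod_erase S _ hX]
      ring
    · intro b x
      rw [dependsOn_update hg (hT X hX)]
      congr 1
      refine Finset.prod_congr rfl fun Y hY => ?_
      rw [Finset.mem_erase] at hY
      refine dependsOn_update (dependsOn_factor B (some Y)) ?_ b x
      rintro (h | h)
      · exact hY.1 (Subtype.ext h.symm)
      · exact hsink Y hY.2 h

theorem chainRule_eq (B : GBN V) (b : Asg V) :
    chainRule B b = factor B none b * ∏ X, factor B (some X) b := rfl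

/-- Probabilities of events about an ancestral set involve only its factors. -/
theorem prob_eq_of_ancestral (B : GBN V) (hB : Acyclic B.graph) {T : Set V}
    (hT : ∀ u v, B.graph.Adj u v → v ∈ T → u ∈ T) {φ : Set (Asg V)}
    (hφ : DependsOn (fun b => b ∈ φ) T) :
    (2 : ℝ) ^ (Finset.univ.filter fun X : {X : V // X ∉ init B.graph} => X.1 ∉ T).card *
        prob (distBN B hB) φ =
      mass (fun b => ∏ k with ∀ X ∈ k, X.1 ∈ T, factor B k b) φ := by
  let g : Asg V → ℝ := fun b => if b ∈ φ then ∏ k with ∀ X ∈ k, X.1 ∈ T, factor B k b else 0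
  -- The factor `iota` is always kept, and its scope may leave `T`.
  have hg : DependsOn g (T ∪ init B.graph) := by
    intro b b' h
    have h1 : (b ∈ φ) = (b' ∈ φ) := hφ fun v hv => h v (.inl hv)
    have h2 : ∏ k with ∀ X ∈ k, X.1 ∈ T, factor B k b =
        ∏ k with ∀ X ∈ k, X.1 ∈ T, factor B k b' := by
      refine Finset.prod_congr rfl fun k hk => dependsOn_factor B k fun v hv => h v ?_
      cases k with
      | none => exact .inr hv
      | some X =>
        have hX : X.1 ∈ T := (Finset.mem_filter.1 hk).2 X rfl
        rcases hv with rfl | hv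
        · exact .inl hX
        · exact .inl (hT _ _ hv hX)
    simp only [g, h1, h2]
  -- Each discarded factor sums to 1 over its variable, whereas a free variable counts 2; hence the
  -- power of two.
  have h := sum_out B hB hg _
    (Finset.univ.filter fun X : {X : V // X ∉ init B.graph} => X.1 ∉ T) rfl fun X hX => by
      rintro (h | h)
      · exact (Finset.mem_filter.1 hX).2 h
      · exact X.2 h
  rw [mass, Finset.sum_filter]
  refine Eq.trans ?_ h
  congr 1
  rw [prob, Finset.sum_filter]
  refine Finset.sum_congr rfl fun b _ => ?_
  by_cases hb : b ∈ φ
  · simp only [hb, if_true, g]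
    change chainRule B b = _
    rw [chainRule_eq, Finset.prod_filter, Fintype.prod_option]
    simp only [Option.mem_def, reduceCtorEq, false_implies, implies_true, if_true,
      Option.some.injEq, forall_eq']
    rw [mul_assoc, ← Finset.prod_filter, Finset.prod_filter_mul_prod_filter_not]
  · simp [hb, g]

theorem prob_mono (μ : Dist (Asg V)) {φ ψ : Set (Asg V)} (h : φ ⊆ ψ) : prob μ φ ≤ prob μ ψ := by
  refine Finset.sum_le_sum_of_subset_of_nonneg ?_ fun b _ _ => μ.2.1 b
  intro b
  simpa using fun hb => h hb

theorem prob_nonneg (μ : Dist (Asg V)) (φ : Set (Asg V)) : 0 ≤ prob μ φ :=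
  Finset.sum_nonneg fun b _ => μ.2.1 b

/-- The product form of conditional independence. -/
theorem prob_mul_prob_of_dSep (B : GBN V) (hB : Acyclic B.graph) {X Y Z : Set V}
    (hsep : (X, Y, Z) ∈ dSep (close B.graph)) (hYZ : Disjoint Y Z)
    (a : Asg X) (b : Asg Y) (c : Asg Z) :
    prob (distBN B hB) (cyl a ∩ (cyl b ∩ cyl c)) * prob (distBN B hB) (cyl c) =
      prob (distBN B hB) (cyl a ∩ cyl c) * prob (distBN B hB) (cyl b ∩ cyl c) := by
  obtain ⟨C, hX, hY, hZ, hinit, hfam⟩ :=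
    exists_separating_set hB hsep hYZ
  set T := ancestors B.graph (X ∪ Y ∪ Z)
  have hT : ∀ u v, B.graph.Adj u v → v ∈ T → u ∈ T := fun _ _ h hv =>
    mem_ancestors_of_adj h hv
  have hsub := subset_ancestors B.graph (X ∪ Y ∪ Z)
  have ha := dependsOn_mem_cyl (fun v hv => hsub (.inl (.inl hv)) : X ⊆ T) a
  have hb := dependsOn_mem_cyl (fun v hv => hsub (.inl (.inr hv)) : Y ⊆ T) b
  have hc := dependsOn_mem_cyl (fun v hv => hsub (.inr hv) : Z ⊆ T) c
  obtain ⟨Φ, Ψ, hΦ, hΨ, hsplit⟩ := exists_split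
    (Finset.univ.filter fun k : Option {X : V // X ∉ init B.graph} => ∀ X ∈ k, X.1 ∈ T)
    (factor B) (scope B) C Z (dependsOn_factor B) (by
      rintro (_ | n) hk
      · exact hinit
      · exact hfam n.1 ((Finset.mem_filter.1 hk).2 n rfl))
  have key := sum_mul_sum_of_split hX hY hZ hΦ hΨ a b c
  simp only [← hsplit] at key
  rw [← prob_eq_of_ancestral B hB hT
      (dependsOn_mem_inter ha (dependsOn_mem_inter hb hc)),
    ← prob_eq_of_ancestral B hB hT hc,
    ← prob_eq_of_ancestral B hB hT (dependsOn_mem_inter ha hc),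
    ← prob_eq_of_ancestral B hB hT (dependsOn_mem_inter hb hc),
    -- Both sides carry the square of the same power of two.
    mul_mul_mul_comm, mul_mul_mul_comm _ _ _ (prob _ (_ ∩ _))] at key
  exact mul_left_cancel₀ (by positivity) key

end Factors

end GenBN

theorem lemma1 {V : Type*} [Fintype V] (B : GenBN.GBN V) (hB : GenBN.Acyclic B.graph) :
    GenBN.dSep (GenBN.close B.graph) ∩ GenBN.DisjointTriples V ⊆
      GenBN.Indep (GenBN.distBN B hB) := by
  rintro ⟨X, Y, Z⟩ ⟨hsep, hdisj⟩
  refine ⟨hdisj, fun a b c => or_iff_not_imp_right.2 fun hbc => ?_⟩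
  dsimp only at a b c hbc ⊢
  have key := GenBN.prob_mul_prob_of_dSep B hB hsep hdisj.2.2 a b c
  -- By monotonicity μ(b,c) ≠ 0 forces μ(c) ≠ 0, so the product identity can be divided.
  have hc0 : GenBN.prob (GenBN.distBN B hB) (GenBN.cyl c) ≠ 0 := fun h0 =>
    hbc (le_antisymm (h0 ▸ GenBN.prob_mono _ Set.inter_subset_right) (GenBN.prob_nonneg _ _))
  exact (div_eq_div_iff hbc hc0).2 key
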